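/- **Model.** A line network has nodes $v_0,\dots,v_L$ ($L\ge 1$) joined in tandem by links $1,\dots,L$ (link $i$ goes from $v_{i-1}$ to $v_i$). The source $v_0$ holds $k$ message vectors over $\mathbb F_2$, and the sink $v_L$ wants all of them. At each time $1,2,3,\dots$ one packet is sent over every link. A packet sent over link $i$ is received, without delay, with probability $p_i\in(0,1]$, and it is lost otherwise; all losses are independent. In a dense code the source sends uniformly random $\mathbb F_2$-linear combinations of the message vectors, and every interior node sends uniformly random $\mathbb F_2$-linear combinations of the packets it has received at earlier times; all coefficients are independent and uniform on $\mathbb F_2$, and independent of the losses. The global encoding vector of a packet is the vector in $\mathbb F_2^k$ of its coefficients with respect to the message vectors. The coding delay is the least time by which the sink has received $k$ packets with linearly independent global encoding vectors ($\infty$ if there is no such time); it is random through both the code and the losses. Put $$p=\min_{1\le i\le L}p_i,\qquad \gamma_e=\min_{1<i\le L}|p_i-p_{i-1}|\quad(\gamma_e=\infty\text{ if }L=1),\qquad \log=\log_2 .$$ **Theorem.** For every message size $k$ let $L=L(k)\ge 1$, let $p_1,\dots,p_L\in(0,1]$ be pairwise distinct (they may depend on $k$), and let $\epsilon=\epsilon(k)\in(0,1)$.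 Let $w=w(k)$ be a real sequence with $$w\sim\left(\frac{kL^2}{\log(kL/\epsilon)}\right)^{1/3}\quad\text{and}\quad w\log\frac{wL}{\epsilon}=o\!\left(\min\Big\{\frac{\gamma_e}{p},1\Big\}\cdot k\right)\qquad(k\to\infty).$$ Then there is a sequence $\eta(k)\to 0$ such that, for all sufficiently large $k$, the coding delay of a dense code with message size $k$ over the line network of $L$ links with success parameters $p_1,\dots,p_L$ is larger than $$\frac1p\left(k+(1+\eta(k))\left(\frac{kL}{w}+\sqrt{k\,w\log\frac{wL}{\epsilon}}\right)\right)$$ with probability at most $\epsilon$. -/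

import Mathlib

open Filter Topology Asymptotics MeasureTheory ProbabilityTheory
open scoped ENNReal unitInterval

noncomputable section

namespace LineNetwork

/-! A line network has nodes `v_0, …, v_L`; link `i : Fin L` goes from `v_i` to `v_{i+1}`.
Every link carries one packet in every time slot `s = 0, 1, 2, …`; slot `s` is the transmission
at time `s + 1`. -/

/-- Losses: `S (s, i)` says whether the packet sent on link `i` in slot `s` is received. -/
abbrev Traffic (L : ℕ) : Type := ℕ × Fin L → Bool

/-- Local encoding coefficients: `c (s, i, j)` is the coefficient that the tail of link `i` uses
in slot `s` for the `j`-th item of its memory. The items of the source are the message vectors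
`0, …, k - 1`; an item of an interior node is named after the slot in which it was received. -/
abbrev Code (L : ℕ) : Type := ℕ × Fin L × ℕ → ZMod 2

/-- Losses are independent, and a packet on link `i` succeeds with probability `p i`. -/
def trafficLaw {L : ℕ} (p : Fin L → I) : Measure (Traffic L) :=
  Measure.infinitePi fun x => bernoulliMeasure true false (p x.2)

/-- All local encoding coefficients are independent and uniform on `𝔽₂`. -/
def codeLaw (L : ℕ) : Measure (Code L) :=
  Measure.infinitePi fun _ => (PMF.uniformOfFintype (ZMod 2)).toMeasure

/-- A random traffic and, independently, a random dense code. -/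
def law {L : ℕ} (p : Fin L → I) : Measure (Traffic L × Code L) :=
  (trafficLaw p).prod (codeLaw L)

/-- Global encoding vector of the packet sent on link `i` in slot `s`, for a message of `k`
vectors: the source combines the message vectors, and an interior node combines the packets that
it received in the earlier slots. -/
def packet (k : ℕ) {L : ℕ} (ω : Traffic L × Code L) :
    (i : ℕ) → i < L → ℕ → (Fin k → ZMod 2)
  | 0, h, s => fun j => ω.2 (s, ⟨0, h⟩, (j : ℕ))
  | i + 1, h, s => ∑ r ∈ (Finset.range s).filter
        (fun r => ω.1 (r, ⟨i, Nat.lt_of_succ_lt h⟩) = true),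
      ω.2 (s, ⟨i + 1, h⟩, r) • packet k ω i (Nat.lt_of_succ_lt h) r

/-- By time `n` the sink has received `k` packets with linearly independent global encoding
vectors, that is, the global encoding vectors received over the last link span `𝔽₂ᵏ`. -/
def Decodable (k : ℕ) {L : ℕ} (hL : 0 < L) (ω : Traffic L × Code L) (n : ℕ) : Prop :=
  Submodule.span (ZMod 2) {v : Fin k → ZMod 2 | ∃ s < n,
    ω.1 (s, ⟨L - 1, Nat.sub_one_lt_of_lt hL⟩) = true ∧
      v = packet k ω (L - 1) (Nat.sub_one_lt_of_lt hL) s} = ⊤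

/-- The least time by which the sink can recover all message vectors (`⊤` if there is none). -/
def codingDelay (k : ℕ) {L : ℕ} (hL : 0 < L) (ω : Traffic L × Code L) : EReal :=
  ⨅ (n : ℕ) (_ : Decodable k hL ω n), ((n : ℝ) : EReal)

/-- `min_i p_i`. -/
def minParam {L : ℕ} (p : Fin L → I) : ℝ := ⨅ i, (p i : ℝ)

/-- `γ_e = min_{1 < i ≤ L} |p_i - p_{i-1}|`; for a single link the minimum is over the empty set
and equals `∞`. -/
def minGap {L : ℕ} (p : Fin L → I) : ℝ≥0∞ :=
  ⨅ (i : Fin L) (j : Fin L) (_ : (i : ℕ) + 1 = (j : ℕ)), ENNReal.ofReal |(p j : ℝ) - (p i : ℝ)|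

/-- `min {γ_e / p, 1}` with `p = min_i p_i`. -/
def gapFactor {L : ℕ} (p : Fin L → I) : ℝ :=
  (min (minGap p / ENNReal.ofReal (minParam p)) 1).toReal

end LineNetwork

end

/-! If the sink cannot decode after `N` slots, some nonzero `f` is orthogonal to every packet it has
received. Fix `f` and the losses, and let `a t i` bound the probability that the head of link `i` is
still ignorant of `f` after `t` slots. A loss leaves `a t i` unchanged. A reception replaces it by
`(a t i + a t (i-1)) / 2`, or by `a t 0 / 2` on the first link, since a uniformly random combination
is orthogonal to `f` with probability one half unless the tail is itself ignorant
(`codeLaw_ignorant_le`).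

A union bound over `f` costs a factor `2 ^ k`. Averaging `a` itself over the losses would give decay
`(1 - P/2) ^ N`, too slow to beat `2 ^ k` near `N = k / P`. Instead a fractional moment is taken:
`min 1 Z ≤ Z ^ θ` for `0 < θ ≤ 1`, and subadditivity of `y ↦ y ^ θ` turns the recursion into a
linear one for the moments (`lintegral_ignorance_rpow_le`). With `2 ^ θ = exp τ` the union bound
costs `exp (k τ)` and the decay is about `exp (-P N τ)`, so the leading terms balance at `N = k /
P`.

What remains is a cost `L log (2 / τ²)` for the links and an error of order `k τ²`, against a gain
`(P N - k) τ`. Put `l = log₂ (k L / ε)` and define `u` by `L l = k u³`. Then `u` is asymptotically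
`L / w`, and an excess of order `k u`, the size of the term `k L / w`, suffices with `τ = u / 24`
(`exponent_le_log`). -/

noncomputable section

namespace LineNetwork

open Function

/-! ### Resampling one coordinate of a product measure, and random combinations over `𝔽₂` -/

section Resampling

variable {ι : Type*} {X : ι → Type*} [∀ i, MeasurableSpace (X i)]
  (μ : (i : ι) → Measure (X i)) [∀ i, IsProbabilityMeasure (μ i)] [DecidableEq ι]

theorem measurable_update_prod (i : ι) :
    Measurable fun z : (∀ i, X i) × X i => update z.1 i z.2 := by
  refine measurable_pi_lambda _ fun j => ?_
  by_cases h : j = i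
  · subst h
    simpa using measurable_snd
  · simp only [update_of_ne h]
    exact (measurable_pi_apply j).comp measurable_fst

/-- Resampling one coordinate does not change a product law. -/
theorem map_update_infinitePi (i : ι) :
    ((Measure.infinitePi μ).prod (μ i)).map (fun z => update z.1 i z.2) =
      Measure.infinitePi μ := by
  refine Measure.eq_infinitePi μ fun s t ht => ?_
  rw [Measure.map_apply (measurable_update_prod i)
    (MeasurableSet.pi s.countable_toSet fun j _ => ht j)]
  by_cases hi : i ∈ s
  · have : (fun z : (∀ i, X i) × X i => update z.1 i z.2) ⁻¹' (Set.pi s t) =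
        (Set.pi (s.erase i : Finset ι) t) ×ˢ t i := by
      ext z
      simp only [Set.mem_preimage, Set.mem_pi, Set.mem_prod, Finset.mem_coe, Finset.mem_erase]
      constructor
      · intro h
        refine ⟨fun j hj => ?_, by simpa using h i hi⟩
        simpa [update_of_ne hj.1] using h j hj.2
      · rintro ⟨h, h'⟩ j hj
        by_cases hji : j = i
        · subst hji; simpa using h'
        · simpa [update_of_ne hji] using h j ⟨hji, hj⟩
    rw [this, Measure.prod_prod, Measure.infinitePi_pi μ fun j _ => ht j, mul_comm,
      Finset.mul_prod_erase s (fun j => μ j (t j)) hi]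
  · have : (fun z : (∀ i, X i) × X i => update z.1 i z.2) ⁻¹' (Set.pi s t) =
        (Set.pi s t) ×ˢ Set.univ := by
      ext z
      simp only [Set.mem_preimage, Set.mem_pi, Set.mem_prod, Finset.mem_coe, Set.mem_univ,
        and_true]
      refine forall₂_congr fun j hj => ?_
      rw [update_of_ne (by rintro rfl; exact hi hj)]
    rw [this, Measure.prod_prod, Measure.infinitePi_pi μ fun j _ => ht j]
    simp

theorem lintegral_infinitePi_update (i : ι) {g : (∀ i, X i) → ℝ≥0∞} (hg : Measurable g) :
    ∫⁻ x, g x ∂Measure.infinitePi μ =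
      ∫⁻ x, ∫⁻ v, g (update x i v) ∂μ i ∂Measure.infinitePi μ := by
  conv_lhs => rw [← map_update_infinitePi μ i]
  rw [lintegral_map hg (measurable_update_prod i),
    lintegral_prod (fun z : (∀ i, X i) × X i => g (update z.1 i z.2))
      (hg.comp (measurable_update_prod i)).aemeasurable]

end Resampling

theorem measurable_mul_zmod {Y : Type*} [MeasurableSpace Y] {f g : Y → ZMod 2}
    (hf : Measurable f) (hg : Measurable g) : Measurable fun y => f y * g y :=
  (Measurable.of_discrete (f := fun z : ZMod 2 × ZMod 2 => z.1 * z.2)).comp (hf.prodMk hg)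

instance (L : ℕ) : IsProbabilityMeasure (codeLaw L) := by unfold codeLaw; infer_instance

instance {L : ℕ} (p : Fin L → I) : IsProbabilityMeasure (trafficLaw p) := by
  unfold trafficLaw; infer_instance

/-- Resampling coordinate `x` keeps `B` fixed and shifts `X` by a uniform bit, so `X` is uniform
conditionally on `B`. -/
theorem measure_inter_eq_zero_of_resampled {L : ℕ} (x : ℕ × Fin L × ℕ) {B : Set (Code L)}
    (hB : MeasurableSet B) (hBx : ∀ c v, update c x v ∈ B ↔ c ∈ B) {X : Code L → ZMod 2}
    (hX : Measurable X) (hXx : ∀ c ∈ B, ∀ v, X (update c x v) = X (update c x 0) + v) :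
    codeLaw L (B ∩ {c | X c = 0}) = codeLaw L B / 2 := by
  have hm : MeasurableSet (B ∩ {c | X c = 0}) :=
    hB.inter (hX (measurableSet_singleton 0))
  rw [← lintegral_indicator_one hm, codeLaw,
    lintegral_infinitePi_update _ x (measurable_one.indicator hm), ← codeLaw,
    div_eq_mul_inv, mul_comm, ← lintegral_indicator_const hB]
  congr 1
  ext c
  rw [lintegral_fintype]
  have hmass (v : ZMod 2) : (PMF.uniformOfFintype (ZMod 2)).toMeasure {v} = 2⁻¹ := by
    rw [PMF.toMeasure_apply_singleton _ _ (measurableSet_singleton v)]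
    simp [ZMod.card]
  simp only [hmass]
  by_cases hc : c ∈ B
  · have key (v : ZMod 2) : (B ∩ {c | X c = 0}).indicator (1 : Code L → ℝ≥0∞) (update c x v) =
        if v = - X (update c x 0) then 1 else 0 := by
      have hiff : update c x v ∈ B ∩ {c | X c = 0} ↔ v = - X (update c x 0) := by
        simp only [Set.mem_inter_iff, hBx, hc, true_and, Set.mem_ofPred_eq, hXx c hc v]
        rw [add_comm, ← eq_neg_iff_add_eq_zero]
      by_cases hv : v = - X (update c x 0)
      · rw [if_pos hv, Set.indicator_of_mem (hiff.2 hv), Pi.one_apply]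
      · rw [if_neg hv, Set.indicator_of_notMem (mt hiff.1 hv)]
    simp only [key, ite_mul, one_mul, zero_mul]
    simp [hc]
  · simp [hc, hBx]

/-- A uniformly random combination of the items `m c r`, `r ∈ T`, vanishes with probability one
half unless all of the items vanish. -/
theorem measure_combination_eq_zero_le {L : ℕ} (t : ℕ) (i : Fin L) (T : Finset ℕ)
    {m : ℕ → Code L → ZMod 2} (hm : ∀ r ∈ T, Measurable (m r)) {V : Set (Code L)}
    (hV : MeasurableSet V) (hmt : ∀ r ∈ T, ∀ c y v, m r (update c (t, y) v) = m r c)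
    (hVt : ∀ c y v, update c (t, y) v ∈ V ↔ c ∈ V) :
    codeLaw L (V ∩ {c | ∑ r ∈ T, c (t, i, r) * m r c = 0}) ≤
      (codeLaw L V + codeLaw L {c | ∀ r ∈ T, m r c = 0}) / 2 := by
  set X : Code L → ZMod 2 := fun c => ∑ r ∈ T, c (t, i, r) * m r c with hXdef
  have hX : Measurable X :=
    Finset.measurable_sum _ fun r hr => measurable_mul_zmod (measurable_pi_apply _) (hm r hr)
  set Z : Set (Code L) := {c | ∀ r ∈ T, m r c = 0} with hZdef
  have hzero (r) (hr : r ∈ T) : MeasurableSet {c | m r c = 0} :=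
    hm r hr (measurableSet_singleton 0)
  have hZ : MeasurableSet Z := by
    have : Z = ⋂ r ∈ T, {c | m r c = 0} := by ext; simp [hZdef]
    rw [this]
    exact Finset.measurableSet_biInter _ fun r hr => hzero r hr
  -- Off `Z`, split according to the first nonvanishing item `r`. Its coefficient is fresh, so it
  -- alone makes the combination uniform on `B r`.
  let B : ℕ → Set (Code L) := fun r => V ∩ ({c | m r c = 0}ᶜ ∩
    ⋂ r' ∈ T.filter (· < r), {c | m r' c = 0})
  have hBm (r) (hr : r ∈ T) : MeasurableSet (B r) :=
    hV.inter ((hzero r hr).compl.inter (Finset.measurableSet_biInter _ fun r' hr' =>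
      hzero r' (Finset.mem_filter.1 hr').1))
  have hdisj : (T : Set ℕ).PairwiseDisjoint B := by
    have aux : ∀ r ∈ T, ∀ r', r < r' → Disjoint (B r) (B r') := by
      intro r hr r' h
      refine Set.disjoint_left.2 fun c hc hc' => hc.2.1 ?_
      have := hc'.2.2
      simp only [Set.mem_iInter, Finset.mem_filter] at this
      exact this r ⟨hr, h⟩
    intro r hr r' hr' hne
    rcases lt_or_gt_of_ne hne with h | h
    · exact aux r hr r' h
    · exact (aux r' hr' r h).symm
  have hunion : V \ Z = ⋃ r ∈ T, B r := by
    ext c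
    simp only [Set.mem_sdiff, Set.mem_iUnion, exists_prop]
    constructor
    · rintro ⟨hcV, hcZ⟩
      have hex : ∃ r, r ∈ T ∧ m r c ≠ 0 := by simpa [hZdef] using hcZ
      classical
      refine ⟨Nat.find hex, (Nat.find_spec hex).1, hcV, (Nat.find_spec hex).2, ?_⟩
      simp only [Set.mem_iInter, Finset.mem_filter, Set.mem_ofPred_eq]
      intro r' hr'
      by_contra hne
      exact Nat.find_min hex hr'.2 ⟨hr'.1, hne⟩
    · rintro ⟨r, hr, hc⟩
      exact ⟨hc.1, fun hcZ => hc.2.1 (hcZ r hr)⟩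
  have hhalf (r) (hr : r ∈ T) : codeLaw L (B r ∩ {c | X c = 0}) = codeLaw L (B r) / 2 := by
    refine measure_inter_eq_zero_of_resampled (t, i, r) (hBm r hr) (fun c v => ?_) hX
      fun c hc v => ?_
    · simp only [B, Set.mem_inter_iff, hVt, Set.mem_compl_iff, Set.mem_ofPred_eq, hmt r hr,
        Set.mem_iInter]
      refine and_congr_right fun _ => and_congr_right fun _ => forall₂_congr fun r' hr' => ?_
      rw [hmt r' (Finset.mem_filter.1 hr').1]
    · have hone : m r c = 1 := by
        have h0 : m r c ≠ 0 := hc.2.1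
        generalize m r c = a at h0
        revert a; decide
      have hrest (v : ZMod 2) : X (update c (t, i, r) v) =
          v + ∑ r' ∈ T.erase r, c (t, i, r') * m r' c := by
        rw [hXdef]
        simp only
        rw [← Finset.add_sum_erase _ _ hr, hmt r hr, hone, update_self, mul_one]
        congr 1
        refine Finset.sum_congr rfl fun r' hr' => ?_
        rw [hmt r' (Finset.mem_of_mem_erase hr'), update_of_ne]
        simpa using Finset.ne_of_mem_erase hr'
      rw [hrest v, hrest 0]
      ring
  -- The factor one half is gained on `V \ Z` only. On `V ∩ Z` the combination vanishes identically,
  -- which is where the second summand of the bound comes from.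
  have h1 : codeLaw L ((V \ Z) ∩ {c | X c = 0}) ≤ codeLaw L (V \ Z) / 2 := by
    calc codeLaw L ((V \ Z) ∩ {c | X c = 0})
        ≤ ∑ r ∈ T, codeLaw L (B r ∩ {c | X c = 0}) := by
          rw [hunion, Set.iUnion₂_inter]
          exact measure_biUnion_finset_le _ _
      _ = ∑ r ∈ T, codeLaw L (B r) / 2 := Finset.sum_congr rfl hhalf
      _ = codeLaw L (V \ Z) / 2 := by
          rw [hunion, measure_biUnion_finset hdisj hBm]
          simp only [div_eq_mul_inv, Finset.sum_mul]
  calc codeLaw L (V ∩ {c | X c = 0})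
      ≤ codeLaw L (((V \ Z) ∩ {c | X c = 0}) ∪ (V ∩ Z)) := by
        refine measure_mono fun c hc => ?_
        by_cases hcZ : c ∈ Z
        · exact Or.inr ⟨hc.1, hcZ⟩
        · exact Or.inl ⟨⟨hc.1, hcZ⟩, hc.2⟩
    _ ≤ codeLaw L (V \ Z) / 2 + codeLaw L (V ∩ Z) := (measure_union_le _ _).trans (by gcongr)
    _ = (codeLaw L V + codeLaw L (V ∩ Z)) / 2 := by
        rw [← measure_inter_add_sdiff V hZ]
        conv_lhs => rw [← ENNReal.add_halves (codeLaw L (V ∩ Z))]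
        simp only [ENNReal.add_div]
        ring
    _ ≤ _ := by
        gcongr
        exact Set.inter_subset_right

/-! ### Ignorance of a functional for fixed losses -/

section Code

variable {k L : ℕ}

theorem measurable_packet (i : ℕ) (h : i < L) (s : ℕ) :
    Measurable fun ω : Traffic L × Code L => packet k ω i h s := by
  induction i generalizing s with
  | zero =>
    refine measurable_pi_lambda _ fun j => ?_
    exact (measurable_pi_apply _).comp measurable_snd
  | succ i ih =>
    simp only [packet, Finset.sum_filter]
    refine Finset.measurable_sum _ fun r _ => Measurable.ite ?_ ?_ measurable_const
    · exact measurableSet_eq_fun ((measurable_pi_apply _).comp measurable_fst) measurable_const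
    · refine measurable_pi_lambda _ fun j => ?_
      exact measurable_mul_zmod ((measurable_pi_apply _).comp measurable_snd)
        ((measurable_pi_apply j).comp (ih _ r))

theorem measurable_dotProduct_packet (f : Fin k → ZMod 2) (i : ℕ) (h : i < L) (s : ℕ) :
    Measurable fun ω : Traffic L × Code L => f ⬝ᵥ packet k ω i h s :=
  Finset.measurable_sum _ fun j _ =>
    ((measurable_pi_apply j).comp (measurable_packet i h s)).const_mul _

theorem packet_update_of_lt (S : Traffic L) (c : Code L) {t : ℕ} (y : Fin L × ℕ) (v : ZMod 2)
    (i : ℕ) (h : i < L) {s : ℕ} (hs : s < t) :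
    packet k (S, update c (t, y) v) i h s = packet k (S, c) i h s := by
  have hne (z : Fin L × ℕ) : ((s, z) : ℕ × Fin L × ℕ) ≠ (t, y) := fun e =>
    hs.ne (congrArg Prod.fst e)
  induction i generalizing s with
  | zero =>
    funext j
    simp only [packet]
    exact update_of_ne (hne _) _ _
  | succ i ih =>
    simp only [packet]
    refine Finset.sum_congr rfl fun r hr => ?_
    have hrs : r < s := Finset.mem_range.1 (Finset.mem_filter.1 hr).1
    rw [update_of_ne (hne _), ih _ (hrs.trans hs) fun z e =>
      (hrs.trans hs).ne (congrArg Prod.fst e)]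

/-- Everything received over link `i` in the first `t` slots is orthogonal to `f`. -/
def ignorant (f : Fin k → ZMod 2) (S : Traffic L) (i : ℕ) (h : i < L) (t : ℕ) : Set (Code L) :=
  {c | ∀ r ∈ (Finset.range t).filter (fun r => S (r, ⟨i, h⟩) = true),
    f ⬝ᵥ packet k (S, c) i h r = 0}

theorem measurableSet_ignorant (f : Fin k → ZMod 2) (S : Traffic L) (i : ℕ) (h : i < L)
    (t : ℕ) : MeasurableSet (ignorant f S i h t) := by
  have : ignorant f S i h t = ⋂ r ∈ (Finset.range t).filter (fun r => S (r, ⟨i, h⟩) = true),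
      {c | f ⬝ᵥ packet k (S, c) i h r = 0} := by
    ext; simp [ignorant]
  rw [this]
  exact Finset.measurableSet_biInter _ fun r _ =>
    ((measurable_dotProduct_packet f i h r).comp measurable_prodMk_left)
      (measurableSet_singleton 0)

theorem update_mem_ignorant (f : Fin k → ZMod 2) (S : Traffic L) (i : ℕ) (h : i < L) (t : ℕ)
    (c : Code L) (y : Fin L × ℕ) (v : ZMod 2) :
    update c (t, y) v ∈ ignorant f S i h t ↔ c ∈ ignorant f S i h t := by
  simp only [ignorant, Set.mem_ofPred_eq]
  refine forall₂_congr fun r hr => ?_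
  rw [packet_update_of_lt _ _ _ _ _ _ (Finset.mem_range.1 (Finset.mem_filter.1 hr).1)]

/-- A bound, for a given traffic, on the probability that the head of link `i` is still ignorant
after `t` slots. -/
def ignorance (S : Traffic L) : ℕ → (i : ℕ) → i < L → ℝ≥0∞
  | 0, _, _ => 1
  | t + 1, 0, h => if S (t, ⟨0, h⟩) = true then ignorance S t 0 h / 2 else ignorance S t 0 h
  | t + 1, i + 1, h =>
    if S (t, ⟨i + 1, h⟩) = true then
      (ignorance S t (i + 1) h + ignorance S t i (Nat.lt_of_succ_lt h)) / 2
    else ignorance S t (i + 1) h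

theorem ignorant_succ_of_lost (f : Fin k → ZMod 2) (S : Traffic L) (i : ℕ) (h : i < L) (t : ℕ)
    (hS : S (t, ⟨i, h⟩) ≠ true) : ignorant f S i h (t + 1) = ignorant f S i h t := by
  simp only [ignorant, Finset.range_add_one, Finset.filter_insert, if_neg hS]

theorem ignorant_succ_of_received (f : Fin k → ZMod 2) (S : Traffic L) (i : ℕ) (h : i < L)
    (t : ℕ) (hS : S (t, ⟨i, h⟩) = true) : ignorant f S i h (t + 1) =
      ignorant f S i h t ∩ {c | f ⬝ᵥ packet k (S, c) i h t = 0} := by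
  ext c
  simp only [ignorant, Finset.range_add_one, Finset.filter_insert, if_pos hS,
    Finset.forall_mem_insert, Set.mem_ofPred_eq, Set.mem_inter_iff]
  exact and_comm

theorem codeLaw_ignorant_le {f : Fin k → ZMod 2} (hf : f ≠ 0) (S : Traffic L) (t i : ℕ)
    (h : i < L) : codeLaw L (ignorant f S i h t) ≤ ignorance S t i h := by
  induction t generalizing i with
  | zero => simpa [ignorance] using prob_le_one
  | succ t ih =>
    by_cases hS : S (t, ⟨i, h⟩) = true
    swap
    · rw [ignorant_succ_of_lost f S i h t hS]
      cases i <;> simpa only [ignorance, if_neg hS] using ih _ h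
    rw [ignorant_succ_of_received f S i h t hS]
    cases i with
    | zero =>
      -- The source's items are the coordinates of `f`, extended by zero because memory is indexed
      -- by `ℕ`. As `f ≠ 0` they never all vanish, so each reception halves the bound.
      let g : ℕ → ZMod 2 := fun j => if hj : j < k then f ⟨j, hj⟩ else 0
      have hsum : {c : Code L | f ⬝ᵥ packet k (S, c) 0 h t = 0} =
          {c | ∑ r ∈ Finset.range k, c (t, ⟨0, h⟩, r) * g r = 0} := by
        ext c
        simp only [Set.mem_ofPred_eq, Finset.sum_range, dotProduct, packet, g, Fin.is_lt,
          dite_true, mul_comm (f _)]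
      have hempty : {c : Code L | ∀ r ∈ Finset.range k, g r = 0} = ∅ := by
        obtain ⟨j, hj⟩ := Function.ne_iff.1 hf
        ext c
        simp only [Set.mem_ofPred_eq, Set.mem_empty_iff_false, iff_false, not_forall]
        exact ⟨j, by simp, by simpa [g] using hj⟩
      have := measure_combination_eq_zero_le (m := fun r _ => g r) t ⟨0, h⟩ (Finset.range k)
        (fun _ _ => measurable_const) (measurableSet_ignorant f S 0 h t)
        (fun _ _ _ _ _ => rfl) (update_mem_ignorant f S 0 h t)
      rw [hempty, measure_empty, add_zero] at this
      simp only [ignorance, if_pos hS, hsum]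
      exact this.trans (by gcongr; exact ih 0 h)
    | succ i =>
      have hi := Nat.lt_of_succ_lt h
      have hsum : {c : Code L | f ⬝ᵥ packet k (S, c) (i + 1) h t = 0} =
          {c | ∑ r ∈ (Finset.range t).filter (fun r => S (r, ⟨i, hi⟩) = true),
            c (t, ⟨i + 1, h⟩, r) * (f ⬝ᵥ packet k (S, c) i hi r) = 0} := by
        ext c
        simp only [packet, dotProduct_sum, dotProduct_smul, smul_eq_mul]
      have := measure_combination_eq_zero_le (m := fun r c => f ⬝ᵥ packet k (S, c) i hi r)
        t ⟨i + 1, h⟩ ((Finset.range t).filter (fun r => S (r, ⟨i, hi⟩) = true))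
        (fun r _ => (measurable_dotProduct_packet f i hi r).comp measurable_prodMk_left)
        (measurableSet_ignorant f S (i + 1) h t)
        (fun r hr c y v => by
          rw [packet_update_of_lt _ _ _ _ _ _ (Finset.mem_range.1 (Finset.mem_filter.1 hr).1)])
        (update_mem_ignorant f S (i + 1) h t)
      simp only [ignorance, if_pos hS, hsum]
      refine this.trans ?_
      gcongr
      · exact ih (i + 1) h
      · exact ih i hi

end Code

/-! ### Fractional moments of the ignorance over random losses -/

section Traffic

variable {L : ℕ}

theorem measurable_ignorance (t i : ℕ) (h : i < L) :
    Measurable fun S : Traffic L => ignorance S t i h := by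
  induction t generalizing i with
  | zero => simpa only [ignorance] using measurable_const
  | succ t ih =>
    have hS (i : ℕ) (h : i < L) : MeasurableSet {S : Traffic L | S (t, ⟨i, h⟩) = true} :=
      measurableSet_eq_fun (measurable_pi_apply _) measurable_const
    cases i with
    | zero =>
      simp only [ignorance]
      exact Measurable.ite (hS 0 h) ((ih 0 h).div_const 2) (ih 0 h)
    | succ i =>
      simp only [ignorance]
      exact Measurable.ite (hS (i + 1) h) (((ih (i + 1) h).add (ih i _)).div_const 2)
        (ih (i + 1) h)

theorem ignorance_update_of_le (S : Traffic L) {s t : ℕ} (hst : s ≤ t) (y : Fin L) (v : Bool)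
    (i : ℕ) (h : i < L) : ignorance (update S (t, y) v) s i h = ignorance S s i h := by
  induction s generalizing i with
  | zero => simp [ignorance]
  | succ s ih =>
    have hne (z : Fin L) : ((s, z) : ℕ × Fin L) ≠ (t, y) := fun e =>
      (Nat.lt_of_succ_le hst).ne (congrArg Prod.fst e)
    have hs : s ≤ t := (Nat.le_succ s).trans hst
    cases i with
    | zero => simp only [ignorance, update_of_ne (hne _), ih hs]
    | succ i => simp only [ignorance, update_of_ne (hne _), ih hs]

theorem lintegral_bernoulliMeasure_bool (p : I) (g : Bool → ℝ≥0∞) :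
    ∫⁻ v, g v ∂bernoulliMeasure true false p =
      ENNReal.ofReal p * g true + ENNReal.ofReal (1 - p) * g false := by
  rw [lintegral_fintype, Fintype.sum_bool,
    bernoulliMeasure_apply_of_mem_of_notMem p (measurableSet_singleton _) (by simp) (by simp),
    bernoulliMeasure_apply_of_notMem_of_mem p (measurableSet_singleton _) (by simp) (by simp)]
  rw [mul_comm (g true), mul_comm (g false)]
  congr 2 <;> rw [ENNReal.ofReal, ENNReal.coe_inj] <;> ext <;> simp [p.2.1, p.2.2]

/-- One step of the moment recursion. Neither `a` nor `b` depends on the loss at `x`, so that loss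
can be averaged first; then `((a + b) / 2) ^ θ ≤ 2 ^ (-θ) * (a ^ θ + b ^ θ)`. -/
theorem lintegral_rpow_le_of_slot (p : Fin L → I) (x : ℕ × Fin L) {θ q : ℝ} (hθ : 0 < θ)
    (hθ1 : θ ≤ 1) (hq : (2 : ℝ) ^ (-θ) = 1 - q) {a b : Traffic L → ℝ≥0∞} (ha : Measurable a)
    (hb : Measurable b) (hax : ∀ S v, a (update S x v) = a S)
    (hbx : ∀ S v, b (update S x v) = b S) {A B : ℝ} (hA : 0 ≤ A) (hB : 0 ≤ B)
    (haA : ∫⁻ S, a S ^ θ ∂trafficLaw p ≤ ENNReal.ofReal A)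
    (hbB : ∫⁻ S, b S ^ θ ∂trafficLaw p ≤ ENNReal.ofReal B) :
    ∫⁻ S, (if S x = true then (a S + b S) / 2 else a S) ^ θ ∂trafficLaw p ≤
      ENNReal.ofReal (p x.2 * (1 - q) * (A + B) + (1 - p x.2) * A) := by
  have hm : Measurable fun S : Traffic L =>
      (if S x = true then (a S + b S) / 2 else a S) ^ θ :=
    (Measurable.ite (measurableSet_eq_fun (measurable_pi_apply _) measurable_const)
      ((ha.add hb).div_const 2) ha).pow_const θ
  have hp0 : 0 ≤ (p x.2 : ℝ) := (p x.2).2.1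
  have hp1 : 0 ≤ 1 - (p x.2 : ℝ) := sub_nonneg.2 (p x.2).2.2
  have hq0 : 0 ≤ 1 - q := hq ▸ by positivity
  have hhalf : (2⁻¹ : ℝ≥0∞) ^ θ = ENNReal.ofReal (1 - q) := by
    rw [← hq, ← ENNReal.ofReal_rpow_of_pos two_pos, ENNReal.rpow_neg, ENNReal.inv_rpow]
    simp
  have hpow (S : Traffic L) :
      ((a S + b S) / 2) ^ θ ≤ ENNReal.ofReal (1 - q) * (a S ^ θ + b S ^ θ) := by
    rw [div_eq_mul_inv, ENNReal.mul_rpow_of_nonneg _ _ hθ.le, hhalf, mul_comm]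
    gcongr
    exact ENNReal.rpow_add_le_add_rpow _ _ hθ.le hθ1
  calc ∫⁻ S, (if S x = true then (a S + b S) / 2 else a S) ^ θ ∂trafficLaw p
      = ∫⁻ S, (ENNReal.ofReal (p x.2) * ((a S + b S) / 2) ^ θ +
          ENNReal.ofReal (1 - p x.2) * a S ^ θ) ∂trafficLaw p := by
        rw [trafficLaw, lintegral_infinitePi_update _ x hm]
        refine lintegral_congr fun S => ?_
        rw [lintegral_bernoulliMeasure_bool]
        simp [hax, hbx]
    _ ≤ ∫⁻ S, (ENNReal.ofReal (p x.2) * (ENNReal.ofReal (1 - q) * (a S ^ θ + b S ^ θ)) +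
          ENNReal.ofReal (1 - p x.2) * a S ^ θ) ∂trafficLaw p := by
        gcongr
        exact hpow _
    _ = ENNReal.ofReal (p x.2) * (ENNReal.ofReal (1 - q) *
          (∫⁻ S, a S ^ θ ∂trafficLaw p + ∫⁻ S, b S ^ θ ∂trafficLaw p)) +
          ENNReal.ofReal (1 - p x.2) * ∫⁻ S, a S ^ θ ∂trafficLaw p := by
        rw [lintegral_add_right _ ((ha.pow_const θ).const_mul _),
          lintegral_const_mul' _ _ ENNReal.ofReal_ne_top,
          lintegral_const_mul' _ _ ENNReal.ofReal_ne_top,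
          lintegral_const_mul' _ _ ENNReal.ofReal_ne_top,
          lintegral_add_right _ (hb.pow_const θ)]
    _ ≤ ENNReal.ofReal (p x.2) * (ENNReal.ofReal (1 - q) *
          (ENNReal.ofReal A + ENNReal.ofReal B)) +
          ENNReal.ofReal (1 - p x.2) * ENNReal.ofReal A := by gcongr
    _ = _ := by
        rw [← ENNReal.ofReal_add hA hB, ← ENNReal.ofReal_mul hq0, ← ENNReal.ofReal_mul hp0,
          ← ENNReal.ofReal_mul hp1, ← ENNReal.ofReal_add (by positivity) (by positivity),
          mul_assoc]

/-- The right-hand side is a supersolution of the recursion. Going back one link multiplies it by `q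
x`, so a step multiplies it by at most `1 - p q + p (1 - q) q x ≤ 1 - p q (1 - x)`. The free
parameter `x` trades the decay rate against the price `(q x)⁻¹` per link. -/
theorem lintegral_ignorance_rpow_le (p : Fin L → I) {P : ℝ} (hP : ∀ i, P ≤ p i) {θ q x : ℝ}
    (hθ : 0 < θ) (hθ1 : θ ≤ 1) (hq : (2 : ℝ) ^ (-θ) = 1 - q) (hq0 : 0 < q) (hx : 0 < x)
    (hx1 : x ≤ 1) (t i : ℕ) (h : i < L) :
    ∫⁻ S, ignorance S t i h ^ θ ∂trafficLaw p ≤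
      ENNReal.ofReal ((q * x)⁻¹ ^ i * (1 - P * (q * (1 - x))) ^ t) := by
  have hq1 : q < 1 := by
    have : (0 : ℝ) < 2 ^ (-θ) := by positivity
    linarith
  have hqx : 0 < q * x := mul_pos hq0 hx
  have hqx1 : q * x ≤ 1 := mul_le_one₀ hq1.le hx.le hx1
  have hstep (i : Fin L) : 1 - p i * (q * (1 - x)) ≤ 1 - P * (q * (1 - x)) := by
    have : 0 ≤ q * (1 - x) := mul_nonneg hq0.le (sub_nonneg.2 hx1)
    nlinarith [hP i]
  have hlam : 0 ≤ 1 - P * (q * (1 - x)) := by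
    refine le_trans ?_ (hstep ⟨i, h⟩)
    have h1 : (p ⟨i, h⟩ : ℝ) ≤ 1 := (p ⟨i, h⟩).2.2
    have h2 : q * (1 - x) ≤ 1 := mul_le_one₀ hq1.le (by linarith) (by linarith)
    have h3 : 0 ≤ q * (1 - x) := mul_nonneg hq0.le (by linarith)
    linarith [mul_le_one₀ h1 h3 h2]
  set lam := 1 - P * (q * (1 - x)) with hlamdef
  induction t generalizing i with
  | zero =>
    have : 1 ≤ (q * x)⁻¹ ^ i := one_le_pow₀ ((one_le_inv₀ hqx).2 hqx1)
    simpa [ignorance] using this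
  | succ t ih =>
    have hp0 : 0 ≤ (p ⟨i, h⟩ : ℝ) := (p ⟨i, h⟩).2.1
    cases i with
    | zero =>
      have := lintegral_rpow_le_of_slot p (t, ⟨0, h⟩) hθ hθ1 hq (measurable_ignorance t 0 h)
        measurable_zero (fun S v => ignorance_update_of_le S le_rfl _ v 0 h) (fun _ _ => rfl)
        (by positivity) le_rfl (ih 0 h) (by simp [hθ])
      simp only [Pi.zero_apply, add_zero] at this
      simp only [ignorance]
      refine this.trans (ENNReal.ofReal_le_ofReal ?_)
      have hpow := pow_nonneg hlam t
      rw [pow_succ, pow_zero, one_mul, one_mul]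
      have := hstep ⟨0, h⟩
      nlinarith [mul_nonneg hp0 (mul_pos hq0 hx).le]
    | succ i =>
      have hi := Nat.lt_of_succ_lt h
      have := lintegral_rpow_le_of_slot p (t, ⟨i + 1, h⟩) hθ hθ1 hq
        (measurable_ignorance t (i + 1) h) (measurable_ignorance t i hi)
        (fun S v => ignorance_update_of_le S le_rfl _ v (i + 1) h)
        (fun S v => ignorance_update_of_le S le_rfl _ v i hi)
        (by positivity) (by positivity) (ih (i + 1) h) (ih i hi)
      simp only [ignorance]
      refine this.trans (ENNReal.ofReal_le_ofReal ?_)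
      set Y := (q * x)⁻¹ ^ (i + 1) * lam ^ t with hY
      have hY0 : 0 ≤ Y := by positivity
      have hprev : (q * x)⁻¹ ^ i * lam ^ t = q * x * Y := by
        rw [hY, pow_succ]; field_simp
      have htarget : (q * x)⁻¹ ^ (i + 1) * lam ^ (t + 1) = lam * Y := by
        rw [hY, pow_succ lam]; ring
      rw [hprev, htarget]
      have h1 := mul_le_mul_of_nonneg_right (hstep ⟨i + 1, h⟩) hY0
      have h2 : 0 ≤ p ⟨i + 1, h⟩ * q * (q * x) * Y := by positivity
      linarith [h1, h2]

end Traffic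

/-! ### Union bound over functionals -/

section Failure

variable {k L : ℕ}

theorem exists_dotProduct_eq_zero_of_span_ne_top {K : Type*} [Field K] {n : Type*} [Fintype n]
    [DecidableEq n] {s : Set (n → K)} (hs : Submodule.span K s ≠ ⊤) :
    ∃ f : n → K, f ≠ 0 ∧ ∀ v ∈ s, f ⬝ᵥ v = 0 := by
  obtain ⟨φ, hφ, hker⟩ := Submodule.exists_le_ker_of_lt_top _ (lt_top_iff_ne_top.2 hs)
  have heq (v : n → K) : (fun i => φ (Pi.single i 1)) ⬝ᵥ v = φ v := by
    rw [LinearMap.pi_apply_eq_sum_univ φ v]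
    refine Finset.sum_congr rfl fun i _ => ?_
    have : (Pi.single i 1 : n → K) = fun j => if i = j then 1 else 0 := by
      ext j
      simp [Pi.single_apply, eq_comm]
    simp only [this, smul_eq_mul, mul_comm]
  refine ⟨fun i => φ (Pi.single i 1), fun h => hφ ?_, fun v hv => ?_⟩
  · exact LinearMap.ext fun v => by rw [← heq v, h]; simp
  · rw [heq v]
    exact hker (Submodule.subset_span hv)

theorem law_not_decodable_le (hL : 0 < L) (p : Fin L → I) {P : ℝ} (hP : ∀ i, P ≤ p i)
    {θ q x : ℝ} (hθ : 0 < θ) (hθ1 : θ ≤ 1) (hq : (2 : ℝ) ^ (-θ) = 1 - q) (hq0 : 0 < q)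
    (hx : 0 < x) (hx1 : x ≤ 1) (N : ℕ) :
    law p {ω | ¬ Decodable k hL ω N} ≤
      ENNReal.ofReal ((2 ^ θ) ^ k * ((q * x)⁻¹ ^ (L - 1) * (1 - P * (q * (1 - x))) ^ N)) := by
  have hl : L - 1 < L := Nat.sub_one_lt_of_lt hL
  let K : (Fin k → ZMod 2) → Set (Traffic L × Code L) := fun f =>
    ⋂ s ∈ Finset.range N, {ω | ω.1 (s, ⟨L - 1, hl⟩) = true → f ⬝ᵥ packet k ω (L - 1) hl s = 0}
  let F : Set (Traffic L × Code L) := ⋃ f ∈ (Finset.univ.filter (· ≠ 0)), K f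
  have hK (f) : MeasurableSet (K f) := by
    refine Finset.measurableSet_biInter _ fun s _ => MeasurableSet.imp ?_ ?_
    · exact measurableSet_eq_fun ((measurable_pi_apply _).comp measurable_fst) measurable_const
    · exact measurable_dotProduct_packet f (L - 1) hl s (measurableSet_singleton 0)
  have hF : MeasurableSet F := Finset.measurableSet_biUnion _ fun f _ => hK f
  have hsub : {ω | ¬ Decodable k hL ω N} ⊆ F := by
    intro ω hω
    obtain ⟨f, hf, h⟩ := exists_dotProduct_eq_zero_of_span_ne_top hω
    simp only [F, K, Set.mem_iUnion, Set.mem_iInter, Finset.mem_filter, Finset.mem_univ,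
      true_and, Finset.mem_range]
    exact ⟨f, hf, fun s hs hS => h _ ⟨s, hs, hS, rfl⟩⟩
  have hsec (S : Traffic L) : codeLaw L (Prod.mk S ⁻¹' F) ≤ 2 ^ k * ignorance S N (L - 1) hl := by
    have : Prod.mk S ⁻¹' F =
        ⋃ f ∈ (Finset.univ.filter (· ≠ (0 : Fin k → ZMod 2))), ignorant f S (L - 1) hl N := by
      ext c
      simp [F, K, ignorant]
    rw [this]
    calc codeLaw L (⋃ f ∈ (Finset.univ.filter (· ≠ (0 : Fin k → ZMod 2))),
          ignorant f S (L - 1) hl N)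
        ≤ ∑ f ∈ Finset.univ.filter (· ≠ (0 : Fin k → ZMod 2)),
            codeLaw L (ignorant f S (L - 1) hl N) := measure_biUnion_finset_le _ _
      _ ≤ ∑ f ∈ Finset.univ.filter (· ≠ (0 : Fin k → ZMod 2)), ignorance S N (L - 1) hl :=
          Finset.sum_le_sum fun f hf =>
            codeLaw_ignorant_le (Finset.mem_filter.1 hf).2 S N (L - 1) hl
      _ ≤ ∑ f : Fin k → ZMod 2, ignorance S N (L - 1) hl :=
          Finset.sum_le_sum_of_subset (Finset.filter_subset _ _)
      _ = 2 ^ k * ignorance S N (L - 1) hl := by simp [ZMod.card]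
  calc law p {ω | ¬ Decodable k hL ω N} ≤ law p F := measure_mono hsub
    _ = ∫⁻ S, codeLaw L (Prod.mk S ⁻¹' F) ∂trafficLaw p := Measure.prod_apply hF
    _ ≤ ∫⁻ S, (2 ^ k) ^ θ * ignorance S N (L - 1) hl ^ θ ∂trafficLaw p := by
        refine lintegral_mono fun S => ?_
        simp only
        rw [← ENNReal.mul_rpow_of_nonneg _ _ hθ.le]
        refine le_trans ?_ (ENNReal.rpow_le_rpow (hsec S) hθ.le)
        -- A probability is at most its `θ`-th power, which lets the fractional moment replace the
        -- mean.
        simpa using ENNReal.rpow_le_rpow_of_exponent_ge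
          (prob_le_one (μ := codeLaw L) (s := Prod.mk S ⁻¹' F)) hθ1
    _ = (2 ^ k) ^ θ * ∫⁻ S, ignorance S N (L - 1) hl ^ θ ∂trafficLaw p := by
        refine lintegral_const_mul _ ((measurable_ignorance N (L - 1) hl).pow_const θ)
    _ ≤ ENNReal.ofReal ((2 ^ θ) ^ k) *
          ENNReal.ofReal ((q * x)⁻¹ ^ (L - 1) * (1 - P * (q * (1 - x))) ^ N) := by
        gcongr
        · rw [ENNReal.ofReal_pow (by positivity), ← ENNReal.ofReal_rpow_of_pos two_pos,
            ← ENNReal.rpow_natCast, ← ENNReal.rpow_natCast, ← ENNReal.rpow_mul,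
            ← ENNReal.rpow_mul, mul_comm]
          simp
        · exact lintegral_ignorance_rpow_le p hP hθ hθ1 hq hq0 hx hx1 N (L - 1) hl
    _ = _ := (ENNReal.ofReal_mul (by positivity)).symm

end Failure

/-! ### Real estimates for the exponent -/

section Estimates

theorem sub_sq_half_le_one_sub_exp_neg {τ : ℝ} (hτ : 0 ≤ τ) :
    τ - τ ^ 2 / 2 ≤ 1 - Real.exp (-τ) := by
  have h1 : 1 + τ + τ ^ 2 / 2 ≤ Real.exp τ := Real.quadratic_le_exp_of_nonneg hτ
  have h2 : Real.exp τ * Real.exp (-τ) = 1 := by rw [← Real.exp_add]; simp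
  have h3 := Real.exp_pos (-τ)
  have h4 : (1 + τ + τ ^ 2 / 2) * Real.exp (-τ) ≤ 1 := by
    exact (mul_le_mul_of_nonneg_right h1 h3.le).trans_eq h2
  -- This product is at least 1, so the second factor dominates the reciprocal of the first, hence
  -- `exp (-τ)`.
  have h5 : (1 + τ + τ ^ 2 / 2) * (1 - τ + τ ^ 2 / 2) = 1 + τ ^ 4 / 4 := by ring
  have h6 : 0 < 1 + τ + τ ^ 2 / 2 := by positivity
  have h7 : Real.exp (-τ) ≤ 1 - τ + τ ^ 2 / 2 := by
    refine le_of_mul_le_mul_left (h4.trans ?_) h6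
    rw [h5]
    have : 0 ≤ τ ^ 4 := by positivity
    linarith
  linarith

/-- The choice `θ = τ / log 2`, `x = τ` gives `q = 1 - exp (-τ)`. Then `q ≥ τ / 2` controls the
price per link and `q (1 - τ) ≥ τ - 3/2 τ²` the decay. -/
theorem failure_bound_le_exp {k L N : ℕ} {P τ : ℝ} (hP0 : 0 ≤ P) (hP1 : P ≤ 1) (hτ : 0 < τ)
    (hτ1 : τ ≤ 1 / 2) :
    (2 ^ (τ / Real.log 2)) ^ k * (((1 - Real.exp (-τ)) * τ)⁻¹ ^ (L - 1) *
        (1 - P * ((1 - Real.exp (-τ)) * (1 - τ))) ^ N) ≤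
      Real.exp (k * τ + L * Real.log (2 / τ ^ 2) - P * N * (τ - 3 / 2 * τ ^ 2)) := by
  set q := 1 - Real.exp (-τ) with hq
  have hql : τ - τ ^ 2 / 2 ≤ q := sub_sq_half_le_one_sub_exp_neg hτ.le
  have hq1 : q ≤ 1 := by linarith [Real.exp_pos (-τ)]
  have hq2 : τ / 2 ≤ q := by nlinarith
  have hq0 : 0 < q := by linarith
  have h1 : ((2 : ℝ) ^ (τ / Real.log 2)) ^ k = Real.exp (k * τ) := by
    rw [Real.rpow_def_of_pos two_pos, mul_div_cancel₀ _ (Real.log_pos one_lt_two).ne',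
      ← Real.exp_nat_mul]
  have hτ2 : 1 ≤ 2 / τ ^ 2 := by rw [le_div_iff₀ (by positivity)]; nlinarith
  have h2 : (q * τ)⁻¹ ^ (L - 1) ≤ Real.exp (L * Real.log (2 / τ ^ 2)) := by
    rw [Real.exp_nat_mul, Real.exp_log (by positivity)]
    calc (q * τ)⁻¹ ^ (L - 1) ≤ (2 / τ ^ 2) ^ (L - 1) := by
          gcongr
          rw [← inv_div]
          gcongr
          nlinarith
      _ ≤ (2 / τ ^ 2) ^ L := pow_le_pow_right₀ hτ2 (Nat.sub_le _ _)
  have h3 : (1 - P * (q * (1 - τ))) ^ N ≤ Real.exp (- (P * N * (τ - 3 / 2 * τ ^ 2))) := by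
    have hq3 : τ - 3 / 2 * τ ^ 2 ≤ q * (1 - τ) := by
      have := mul_le_mul_of_nonneg_right hql (show 0 ≤ 1 - τ by linarith)
      have h3 : 0 ≤ τ ^ 3 := by positivity
      linarith [this, h3, show (τ - τ ^ 2 / 2) * (1 - τ) = τ - 3 / 2 * τ ^ 2 + τ ^ 3 / 2 by ring]
    have hnn : 0 ≤ 1 - P * (q * (1 - τ)) := by
      have : q * (1 - τ) ≤ 1 := mul_le_one₀ hq1 (by linarith) (by linarith)
      have h0 : 0 ≤ q * (1 - τ) := mul_nonneg hq0.le (by linarith)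
      linarith [mul_le_one₀ hP1 h0 this]
    calc (1 - P * (q * (1 - τ))) ^ N ≤ Real.exp (- (P * (q * (1 - τ)))) ^ N :=
          pow_le_pow_left₀ hnn (Real.one_sub_le_exp_neg _) N
      _ = Real.exp (- (P * N * (q * (1 - τ)))) := by
          rw [← Real.exp_nat_mul]; congr 1; ring
      _ ≤ _ := by gcongr
  have hnn : 0 ≤ (1 - P * (q * (1 - τ))) ^ N := by
    refine pow_nonneg ?_ N
    have : q * (1 - τ) ≤ 1 := mul_le_one₀ hq1 (by linarith) (by linarith)
    have h0 : 0 ≤ q * (1 - τ) := mul_nonneg hq0.le (by linarith)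
    linarith [mul_le_one₀ hP1 h0 this]
  rw [h1, sub_eq_add_neg (_ + _) (P * N * _), add_assoc, Real.exp_add, Real.exp_add]
  gcongr

/-- The terms linear in `u` cancel. The excess `K u / 4` gains `K u² / 96`, the second-order loss is
`K u² / 384`, and the links together with `log ε` cost at most `3 L l = 3 K u³ ≤ K u² / 192`; this
last bound uses `u ≤ 1 / 576`. The surplus `K u² / 384` covers the cubic term. -/
theorem exponent_le_log {K L l u ε M : ℝ} (hK : 1 ≤ K) (hL : 1 ≤ L) (hl : 11 ≤ l)
    (hu0 : 0 < u) (hu : u ≤ 1 / 576) (hul : L * l = K * u ^ 3) (hKl : Real.log K ≤ l)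
    (hεl : - Real.log ε ≤ l) (hM : K + K * u / 4 ≤ M) :
    K * (u / 24) + L * Real.log (2 / (u / 24) ^ 2) -
      M * (u / 24 - 3 / 2 * (u / 24) ^ 2) ≤ Real.log ε := by
  have hK0 : 0 < K := by linarith
  have hlog : Real.log (2 / (u / 24) ^ 2) ≤ 2 * l := by
    -- From `K u² ≥ K u³ = L l ≥ 1`. The factor `2 ^ 11` is then absorbed by `l ≥ 11`.
    have h1 : 2 / (u / 24) ^ 2 ≤ 2 ^ 11 * K := by
      rw [div_le_iff₀ (by positivity)]
      have h2 : 1 ≤ K * u ^ 3 := by rw [← hul]; nlinarith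
      have h3 : K * u ^ 3 ≤ K * u ^ 2 :=
        mul_le_mul_of_nonneg_left (pow_le_pow_of_le_one hu0.le (by linarith) (by norm_num)) hK0.le
      linarith [h2, h3, show 2 ^ 11 * K * (u / 24) ^ 2 = 2048 / 576 * (K * u ^ 2) by ring]
    have h2 := Real.log_le_log (by positivity) h1
    rw [Real.log_mul (by positivity) hK0.ne', Real.log_pow] at h2
    have h3 := Real.log_two_lt_d9
    push_cast at h2
    linarith
  have hcoef : 0 ≤ u / 24 - 3 / 2 * (u / 24) ^ 2 := by nlinarith
  have h1 := mul_le_mul_of_nonneg_right hM hcoef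
  have h2 : L * Real.log (2 / (u / 24) ^ 2) ≤ L * (2 * l) :=
    mul_le_mul_of_nonneg_left hlog (by linarith)
  have h3 : l ≤ L * l := by nlinarith
  have h4 : 3 * (L * l) ≤ K * u ^ 2 / 192 := by
    rw [hul]
    have : 0 < K * u ^ 2 := by positivity
    nlinarith
  have h5 : 0 ≤ K * u ^ 2 := by positivity
  have h6 : K * u ^ 3 ≤ K * u ^ 2 :=
    mul_le_mul_of_nonneg_left (pow_le_pow_of_le_one hu0.le (by linarith) (by norm_num)) hK0.le
  have h7 : (K + K * u / 4) * (u / 24 - 3 / 2 * (u / 24) ^ 2) =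
    K * (u / 24) + K * u ^ 2 / 96 - K * u ^ 2 / 384 - K * u ^ 3 / 1536 := by ring
  linarith

/-- Makes the logarithm in the growth condition comparable with the one defining `W`. With `y = K L
/ ε` and `z = w L / ε`, the cube of `W / 2` gives `z³ ≥ y / (8 l)`, and `(8 l)⁴ ≤ y` upgrades this
to `y³ ≤ z¹²`. -/
theorem logb_le_four_mul_logb {K L l ε w W : ℝ} (hK : 0 < K) (hL : 1 ≤ L) (hε0 : 0 < ε)
    (hε1 : ε ≤ 1) (hl0 : 0 < l) (hl : (8 * l) ^ 4 ≤ K * L / ε) (hW0 : 0 < W)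
    (hW : W ^ 3 = K * L ^ 2 / l) (hw : W / 2 ≤ w) :
    Real.logb 2 (K * L / ε) ≤ 4 * Real.logb 2 (w * L / ε) := by
  have hL0 : 0 < L := by linarith
  have hw0 : 0 < w := by linarith
  set y := K * L / ε with hy
  have hy0 : 0 < y := by positivity
  set z := w * L / ε with hz
  have hz0 : 0 < z := by positivity
  have h1 : y / (8 * l) ≤ z ^ 3 := by
    calc y / (8 * l) ≤ y / (8 * l) * (L ^ 4 / ε ^ 2) := by
          refine le_mul_of_one_le_right (by positivity) ?_
          rw [one_le_div (by positivity)]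
          exact (pow_le_one₀ hε0.le hε1).trans (one_le_pow₀ hL)
      _ = ((W / 2) * L / ε) ^ 3 := by
          rw [div_pow, mul_pow, div_pow, hW, hy]; field_simp; norm_num
      _ ≤ z ^ 3 := by rw [hz]; gcongr
  have h2 : y ^ 3 ≤ z ^ 12 := by
    calc y ^ 3 ≤ (y / (8 * l)) ^ 4 := by
          rw [div_pow y, le_div_iff₀ (by positivity)]
          calc y ^ 3 * (8 * l) ^ 4 ≤ y ^ 3 * y := by gcongr
            _ = y ^ 4 := by ring
      _ ≤ (z ^ 3) ^ 4 := by gcongr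
      _ = z ^ 12 := by ring
  have h3 := Real.logb_le_logb_of_le one_lt_two (by positivity) h2
  rw [Real.logb_pow, Real.logb_pow] at h3
  push_cast at h3
  linarith

theorem log_le_logb_two {y : ℝ} (hy : 1 ≤ y) : Real.log y ≤ Real.logb 2 y := by
  rw [Real.logb, le_div_iff₀ (Real.log_pos one_lt_two)]
  exact mul_le_of_le_one_right (Real.log_nonneg hy) (by linarith [Real.log_two_lt_d9])

theorem eventually_logb_two_bounds :
    ∀ᶠ y : ℝ in atTop, (8 * Real.logb 2 y) ^ 4 ≤ y ∧ 11 ≤ Real.logb 2 y := by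
  refine Eventually.and ?_ ((Real.tendsto_logb_atTop one_lt_two).eventually_ge_atTop 11)
  have hlog := Real.log_pos one_lt_two
  have h := (Real.isLittleO_pow_log_id_atTop (n := 4)).def
    (c := (8 / Real.log 2)⁻¹ ^ 4) (by positivity)
  filter_upwards [h, eventually_ge_atTop 0] with y hy hy0
  rw [id, Real.norm_of_nonneg hy0, Real.norm_of_nonneg (by positivity), inv_pow,
    ← div_eq_inv_mul, le_div_iff₀ (by positivity), ← mul_pow] at hy
  rw [Real.logb, show 8 * (Real.log y / Real.log 2) = Real.log y * (8 / Real.log 2) by ring]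
  exact hy

end Estimates

/-! ### From the failure bound to the coding delay -/

theorem minParam_le {L : ℕ} (p : Fin L → I) (i : Fin L) : minParam p ≤ p i :=
  ciInf_le (Set.finite_range _).bddBelow i

theorem minParam_pos {L : ℕ} (hL : 0 < L) (p : Fin L → I) (hp : ∀ i, (0 : ℝ) < p i) :
    0 < minParam p := by
  have : Nonempty (Fin L) := ⟨⟨0, hL⟩⟩
  obtain ⟨i, hi⟩ := exists_eq_ciInf_of_finite (f := fun i => (p i : ℝ))
  rw [minParam, ← hi]
  exact hp i

theorem gapFactor_nonneg {L : ℕ} (p : Fin L → I) : 0 ≤ gapFactor p := ENNReal.toReal_nonneg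

theorem gapFactor_le_one {L : ℕ} (p : Fin L → I) : gapFactor p ≤ 1 :=
  ENNReal.toReal_mono ENNReal.one_ne_top (min_le_right _ _)

theorem codingDelay_le_of_decodable {k L : ℕ} (hL : 0 < L) {ω : Traffic L × Code L} {n : ℕ}
    (h : Decodable k hL ω n) : codingDelay k hL ω ≤ ((n : ℝ) : EReal) :=
  iInf₂_le n h

theorem law_lt_codingDelay_le {k L : ℕ} (hk : 0 < k) (hL : 0 < L) (p : Fin L → I)
    (hp : ∀ i, (0 : ℝ) < p i) {ε u l D : ℝ} (hε0 : 0 < ε) (hl : 11 ≤ l)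
    (hu0 : 0 < u) (hu : u ≤ 1 / 576) (hul : L * l = k * u ^ 3) (hKl : Real.log k ≤ l)
    (hεl : - Real.log ε ≤ l) (hD : k * u / 2 ≤ D) :
    law p {ω | ((1 / minParam p * (k + D) : ℝ) : EReal) < codingDelay k hL ω} ≤
      ENNReal.ofReal ε := by
  have hP := minParam_pos hL p hp
  have hP1 : minParam p ≤ 1 := (minParam_le p ⟨0, hL⟩).trans (p ⟨0, hL⟩).2.2
  have hK : (1 : ℝ) ≤ k := by exact_mod_cast hk
  have hL1 : (1 : ℝ) ≤ L := by exact_mod_cast hL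
  have hku : 4 ≤ k * u := by
    have h1 : (k : ℝ) * u ^ 3 ≤ k * u ^ 1 :=
      mul_le_mul_of_nonneg_left (pow_le_pow_of_le_one hu0.le (by linarith) (by norm_num))
        (by linarith)
    rw [pow_one] at h1
    nlinarith
  set b := 1 / minParam p * (k + D) with hb
  have hb0 : 0 ≤ b := mul_nonneg (by positivity) (by linarith)
  set N := ⌊b⌋₊ with hN
  -- Rounding down to a whole slot loses at most `minParam p ≤ 1`, which half of the excess `k u /
  -- 2` covers because `k u ≥ 4`.
  have hPN : k + k * u / 4 ≤ minParam p * N := by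
    have h1 : minParam p * b = k + D := by rw [hb]; field_simp
    have h2 := mul_le_mul_of_nonneg_left (Nat.lt_floor_add_one b).le hP.le
    rw [← hN, mul_add, h1] at h2
    linarith
  have hsub : {ω | (b : EReal) < codingDelay k hL ω} ⊆ {ω | ¬ Decodable k hL ω N} := by
    intro ω hω hdec
    refine absurd hω (not_lt.2 ((codingDelay_le_of_decodable hL hdec).trans ?_))
    exact EReal.coe_le_coe_iff.2 (Nat.floor_le hb0)
  have hτ0 : 0 < u / 24 := by positivity
  have hlog2 := Real.log_pos one_lt_two
  have hexp : Real.exp (-(u / 24)) < 1 := Real.exp_lt_one_iff.2 (by linarith)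
  refine (measure_mono hsub).trans ((law_not_decodable_le hL p (minParam_le p)
    (θ := u / 24 / Real.log 2) (q := 1 - Real.exp (-(u / 24))) (x := u / 24) (by positivity)
    ?_ ?_ (by linarith) hτ0 (by linarith) N).trans (ENNReal.ofReal_le_ofReal ?_))
  · rw [div_le_one hlog2]
    linarith [Real.log_two_gt_d9]
  · rw [Real.rpow_def_of_pos two_pos, mul_neg, mul_div_cancel₀ _ hlog2.ne']
    ring
  · refine (failure_bound_le_exp hP.le hP1 hτ0 (by linarith)).trans ?_
    rw [← Real.le_log_iff_exp_le hε0]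
    exact exponent_le_log hK hL1 hl hu0 hu hul hKl hεl hPN

end LineNetwork

end

theorem mainTheorem7
    -- For each message size `k`: number of links, success parameters, failure probability, `w`.
    (L : ℕ → ℕ) (hL : ∀ k, 0 < L k)
    (p : (k : ℕ) → Fin (L k) → unitInterval)
    (hp_pos : ∀ k i, (0 : ℝ) < p k i)
    (hp_unequal : ∀ k, Function.Injective (p k))
    (ε : ℕ → ℝ) (hε : ∀ k, 0 < ε k ∧ ε k < 1)
    (w : ℕ → ℝ)
    (hw : w ~[atTop] fun k =>
      ((k : ℝ) * (L k : ℝ) ^ 2 / Real.logb 2 ((k : ℝ) * (L k : ℝ) / ε k)) ^ ((1 : ℝ) / 3))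
    (hcond : (fun k => w k * Real.logb 2 (w k * (L k : ℝ) / ε k)) =o[atTop]
      fun k => LineNetwork.gapFactor (p k) * (k : ℝ)) :
    ∃ η : ℕ → ℝ, Tendsto η atTop (𝓝 0) ∧
      ∀ᶠ k : ℕ in atTop,
        LineNetwork.law (p k)
          {ω | ((1 / LineNetwork.minParam (p k) *
                ((k : ℝ) + (1 + η k) * ((k : ℝ) * (L k : ℝ) / w k +
                  √((k : ℝ) * (w k * Real.logb 2 (w k * (L k : ℝ) / ε k))))) : ℝ) : EReal) <
              LineNetwork.codingDelay k (hL k) ω}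
          ≤ ENNReal.ofReal (ε k) := by
  -- No vanishing correction is needed: an excess `k u / 2` suffices, the term `k L / w` already
  -- supplies it, and the square root is only used as nonnegative.
  refine ⟨fun _ => 0, tendsto_const_nhds, ?_⟩
  have hy : Tendsto (fun k : ℕ => (k : ℝ) * (L k : ℝ) / ε k) atTop atTop := by
    refine tendsto_atTop_mono (fun k => ?_) tendsto_natCast_atTop_atTop
    rw [le_div_iff₀ (hε k).1]
    have : (1 : ℝ) ≤ L k := by exact_mod_cast hL k
    gcongr
    linarith [(hε k).2]
  have hw2 := hw.isLittleO.def (c := 1 / 2) (by norm_num)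
  have hc2 := hcond.def (c := (1 / 576) ^ 2 / 8) (by norm_num)
  filter_upwards [hy.eventually LineNetwork.eventually_logb_two_bounds, hw2, hc2,
    eventually_gt_atTop 0] with k hlk hwk hck hk
  obtain ⟨hl4, hl⟩ := hlk
  set l := Real.logb 2 ((k : ℝ) * (L k : ℝ) / ε k) with hldef
  set W := ((k : ℝ) * (L k : ℝ) ^ 2 / l) ^ ((1 : ℝ) / 3) with hWdef
  obtain ⟨hε0, hε1⟩ := hε k
  have hl0 : 0 < l := by linarith
  have hK : (1 : ℝ) ≤ k := by exact_mod_cast hk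
  have hK0 : (0 : ℝ) < k := by linarith
  have hL1 : (1 : ℝ) ≤ L k := by exact_mod_cast hL k
  have hL0 : (0 : ℝ) < L k := by linarith
  have hbase : 0 < (k : ℝ) * (L k : ℝ) ^ 2 / l := by positivity
  have hW0 : 0 < W := Real.rpow_pos_of_pos hbase _
  have hW3 : W ^ 3 = k * (L k : ℝ) ^ 2 / l := by
    rw [hWdef, ← Real.rpow_natCast, ← Real.rpow_mul hbase.le]
    norm_num
  rw [Pi.sub_apply, Real.norm_eq_abs, Real.norm_of_nonneg hW0.le, abs_le] at hwk
  have hwl : W / 2 ≤ w k := by linarith [hwk.1]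
  have hwu : w k ≤ 2 * W := by linarith [hwk.2]
  have hw0 : 0 < w k := by linarith
  have hll := LineNetwork.logb_le_four_mul_logb hK0 hL1 hε0 hε1.le hl0 hl4 hW0 hW3 hwl
  rw [← hldef] at hll
  set l' := Real.logb 2 (w k * (L k : ℝ) / ε k) with hl'
  set u := (L k : ℝ) / W with hu
  have hu0 : 0 < u := by positivity
  have hul : (L k : ℝ) * l = k * u ^ 3 := by
    rw [hu, div_pow, hW3]; field_simp
  -- Since `W l = k u²`, the bounds `w ≥ W / 2` and `l' ≥ l / 4` give `w l' ≥ k u² / 8`. The growth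
  -- condition, with `gapFactor ≤ 1`, bounds `w l'` by a small multiple of `k`, and so forces `u` to
  -- be small.
  have hu1 : u ≤ 1 / 576 := by
    have h1 : k * u ^ 2 / 8 ≤ w k * l' := by
      calc k * u ^ 2 / 8 = W / 2 * (l / 4) := by
            have : W = L k / u := by rw [hu]; field_simp
            rw [this]
            field_simp
            linarith
        _ ≤ w k * l' := by
            have : l / 4 ≤ l' := by linarith
            gcongr
    have h2 : w k * l' ≤ (1 / 576) ^ 2 / 8 * k := by
      refine (le_abs_self _).trans (hck.trans ?_)
      rw [Real.norm_of_nonneg (mul_nonneg (LineNetwork.gapFactor_nonneg _) hK0.le)]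
      have := mul_le_of_le_one_left hK0.le (LineNetwork.gapFactor_le_one (p k))
      gcongr
    have h3 : u ^ 2 ≤ (1 / 576) ^ 2 := by
      refine le_of_mul_le_mul_left ?_ hK0
      linarith
    exact (pow_le_pow_iff_left₀ hu0.le (by norm_num) two_ne_zero).1 h3
  have hlogK : Real.log k ≤ l := by
    refine (LineNetwork.log_le_logb_two hK).trans
      (Real.logb_le_logb_of_le one_lt_two hK0 ?_)
    rw [le_div_iff₀ hε0]
    gcongr
    linarith
  have hlogε : - Real.log (ε k) ≤ l := by
    rw [← Real.log_inv]
    refine (LineNetwork.log_le_logb_two ((one_le_inv₀ hε0).2 hε1.le)).trans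
      (Real.logb_le_logb_of_le one_lt_two (by positivity) ?_)
    rw [inv_eq_one_div]
    gcongr
    exact one_le_mul_of_one_le_of_one_le hK hL1
  refine LineNetwork.law_lt_codingDelay_le hk (hL k) (p k) (hp_pos k) hε0 hl hu0 hu1 hul hlogK
    hlogε ?_
  have h1 : k * u / 2 ≤ k * (L k : ℝ) / w k := by
    calc k * u / 2 = k * (L k : ℝ) / (2 * W) := by rw [hu]; field_simp
      _ ≤ k * (L k : ℝ) / w k := by gcongr
  have h2 := Real.sqrt_nonneg ((k : ℝ) * (w k * l'))
  linarith
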